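/- Let $K$ and $H$ be complex Hilbert spaces, let $S\subset B(K)$ be an operator system, that is, a self-adjoint linear subspace (not necessarily closed) containing the identity operator, and let $A=\mathrm{C}^*(S)\subset B(K)$ be the $\mathrm{C}^*$-algebra generated by $S$. Assume that $S$ is norm-separable, and that every irreducible $*$-representation $\sigma:A\to B(L)$ on a non-zero Hilbert space $L$ with $\sigma(I)=I$ is a boundary representation for $S$; that is, the only completely positive map $\varphi:A\to B(L)$ with $\varphi|_S=\sigma|_S$ is $\varphi=\sigma$. Let $\pi:A\to B(H)$ be a unital $*$-representation, and let $\Pi:A\to B(H)$ be a unital completely positive map with $\Pi|_S=\pi|_S$. Then the pair $((\Pi-\pi)(A),\pi(A))$ is unperforated if and only if $\Pi=\pi$. In particular, if every element of $(\Pi-\pi)(A)$ commutes with every element of $\pi(A)$, then $\Pi=\pi$. Here a pair $(X,Y)$ of self-adjoint linear subspaces of a unital $\mathrm{C}^*$-algebra (here, of $B(H)$) is called unperforated if for all self-adjoint $a\in X$ and $b\in Y$ with $a\le b$ there is a self-adjoint $b'\in Y$ with $\|b'\|\le\|a\|$ and $a\le b'\le b$. -/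

import Mathlib

open scoped CStarAlgebra

universe u v

/-- A (concrete) operator system on a Hilbert space `K`: a unital self-adjoint linear subspace of
`B(K)`. It need not be closed. -/
structure OperatorSystem (K : Type u) [NormedAddCommGroup K] [InnerProductSpace ℂ K]
    [CompleteSpace K] extends Submodule ℂ (K →L[ℂ] K) where
  one_mem' : (1 : K →L[ℂ] K) ∈ carrier
  star_mem' : ∀ {s : K →L[ℂ] K}, s ∈ carrier → star s ∈ carrier

namespace OperatorSystem

variable {K : Type u} [NormedAddCommGroup K] [InnerProductSpace ℂ K] [CompleteSpace K]

/-- `C*(S)`: the norm-closed unital `*`-subalgebra of `B(K)` generated by `S`. -/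
noncomputable def cstar (S : OperatorSystem K) : StarSubalgebra ℂ (K →L[ℂ] K) :=
  (StarAlgebra.adjoin ℂ (S.carrier : Set (K →L[ℂ] K))).topologicalClosure

instance isClosed_cstar (S : OperatorSystem K) : IsClosed (S.cstar : Set (K →L[ℂ] K)) :=
  StarSubalgebra.isClosed_topologicalClosure _

/-- `C*(S)` contains the square roots of its positive elements. -/
theorem exists_sqrt_mem_cstar (S : OperatorSystem K) {x : K →L[ℂ] K} (hx : x ∈ S.cstar)
    (h : 0 ≤ x) : ∃ p ∈ S.cstar, x = star p * p := by
  refine ⟨cfc Real.sqrt x, cfc_mem (𝕜 := ℝ) (𝕜' := ℂ) _ hx, ?_⟩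
  rw [← cfc_star, ← cfc_mul _ _ x]
  conv_lhs => rw [← cfc_id ℝ x h.isSelfAdjoint]
  refine cfc_congr fun r hr => ?_
  simp [Real.mul_self_sqrt (spectrum_nonneg_of_nonneg h hr)]

/-- With the order inherited from `B(K)`, in which `0 ≤ a` means that `a` is a positive operator,
`C*(S)` is a star-ordered ring. -/
instance (S : OperatorSystem K) : StarOrderedRing S.cstar := by
  refine StarOrderedRing.of_nonneg_iff' (fun {x y} h z => ?_) (fun x => ⟨fun hx => ?_, ?_⟩)
  · have h' : (x : K →L[ℂ] K) ≤ y := h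
    have : (z : K →L[ℂ] K) + x ≤ z + y := by gcongr
    exact this
  · obtain ⟨p, hp, hxp⟩ := S.exists_sqrt_mem_cstar x.2 hx
    exact ⟨⟨p, hp⟩, Subtype.ext hxp⟩
  · rintro ⟨s, rfl⟩
    exact star_mul_self_nonneg (s : K →L[ℂ] K)

variable {L : Type v} [NormedAddCommGroup L] [InnerProductSpace ℂ L] [CompleteSpace L]

/-- A completely positive map `ψ : C*(S) → B(L)` has the unique extension property with respect to
`S` if `ψ` is the only completely positive extension of `ψ|S` to `C*(S)`. -/
def HasUniqueExtensionProperty (S : OperatorSystem K) (ψ : S.cstar →CP (L →L[ℂ] L)) : Prop :=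
  ∀ φ : S.cstar →CP (L →L[ℂ] L),
    (∀ a : S.cstar, (a : K →L[ℂ] K) ∈ S.carrier → φ a = ψ a) → φ = ψ

end OperatorSystem

/-- A unital `*`-representation `σ : A → B(L)` is irreducible if `L ≠ 0` and the only closed
subspaces of `L` invariant under `σ(A)` are `0` and `L`. -/
def IsIrreducibleRep {A : Type u} [CStarAlgebra A] {L : Type v} [NormedAddCommGroup L]
    [InnerProductSpace ℂ L] [CompleteSpace L] (σ : A →⋆ₐ[ℂ] (L →L[ℂ] L)) : Prop :=
  Nontrivial L ∧ ∀ V : Submodule ℂ L, IsClosed (V : Set L) →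
    (∀ a : A, ∀ x ∈ V, σ a x ∈ V) → V = ⊥ ∨ V = ⊤

/-- A boundary representation for `S`: an irreducible `*`-representation of `C*(S)` having the
unique extension property with respect to `S`. -/
def OperatorSystem.IsBoundaryRep {K : Type u} [NormedAddCommGroup K] [InnerProductSpace ℂ K]
    [CompleteSpace K] (S : OperatorSystem K) {L : Type v} [NormedAddCommGroup L]
    [InnerProductSpace ℂ L] [CompleteSpace L] (σ : S.cstar →⋆ₐ[ℂ] (L →L[ℂ] L)) : Prop :=
  IsIrreducibleRep σ ∧
    S.HasUniqueExtensionProperty (CompletelyPositiveMapClass.toCompletelyPositiveLinearMap σ)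

/-- A pair `(S, T)` of (self-adjoint) subspaces of a unital C*-algebra is unperforated if for all
self-adjoint `a ∈ S`, `b ∈ T` with `a ≤ b` there is a self-adjoint `b' ∈ T` with `‖b'‖ ≤ ‖a‖` and
`a ≤ b' ≤ b`. -/
def IsUnperforated {B : Type u} [CStarAlgebra B] [PartialOrder B] [StarOrderedRing B]
    (S T : Submodule ℂ B) : Prop :=
  ∀ a ∈ S, IsSelfAdjoint a → ∀ b ∈ T, IsSelfAdjoint b → a ≤ b →
    ∃ b' ∈ T, IsSelfAdjoint b' ∧ ‖b'‖ ≤ ‖a‖ ∧ a ≤ b' ∧ b' ≤ b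

/-! Suppose `Φ ≠ π` and choose a nonzero self-adjoint `a` in the range of `Φ - π` with `‖a‖` in its
spectrum. The goal is a state `ψ` of `B(H)` with `ψ a = ‖a‖` whose restriction to `π(A)` is pure.

The states of `π(A)` taking the value `‖a‖` at every element of norm at most `‖a‖` above `a` form a
nonempty closed face (`nonempty_dominatingFace`), so this face contains a pure state `f`.
Unperforation inserts such an element below any element of `π(A)` above `a`, so `f ≥ ‖a‖` on all of
these. Hahn–Banach (`exists_positive_extension`) then extends `f` to `ψ` with `ψ a ≥ ‖a‖`.

Purity makes the GNS representation of `ψ ∘ π` irreducible, hence a boundary representation. It sits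
isometrically inside the GNS representation of `ψ`. Compressing the latter, composed with `Φ`, gives
a completely positive map agreeing with it on `S`, hence everywhere. At the cyclic vector this says
`ψ ∘ Φ = ψ ∘ π`, so `ψ a = 0`, a contradiction.

Commuting pairs are unperforated by truncating `b` at `±‖a‖`. -/

/-! ### Order in C*-algebras and commuting pairs -/

section Order

variable {B : Type*} [CStarAlgebra B] [PartialOrder B] [StarOrderedRing B]

theorem nonneg_of_negPart_eq_zero {x : B} (hx : IsSelfAdjoint x) (h : x⁻ = 0) : 0 ≤ x := by
  rw [← CFC.posPart_sub_negPart x hx, h, sub_zero]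
  exact CFC.posPart_nonneg x

theorem negPart_mul_self {B : Type*} [CStarAlgebra B] {x : B} (hx : IsSelfAdjoint x) : x⁻ * x = -(x⁻ * x⁻) := by
  have := congrArg (x⁻ * ·) (CFC.posPart_sub_negPart x hx)
  simpa [mul_sub] using this.symm

/-- An injective `*`-homomorphism reflects positivity of self-adjoint elements. -/
theorem nonneg_of_map_nonneg {C : Type*} [NonUnitalCStarAlgebra C] [PartialOrder C]
    [StarOrderedRing C] (ρ : B →⋆ₙₐ[ℂ] C) (hρ : Function.Injective ρ) {x : B}
    (h : 0 ≤ ρ x) : 0 ≤ x := by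
  have hx : IsSelfAdjoint x := hρ (by rw [map_star]; exact h.isSelfAdjoint)
  refine nonneg_of_negPart_eq_zero hx ?_
  have h0 : 0 ≤ x⁻ := CFC.negPart_nonneg x
  -- Conjugating by `x⁻` leaves minus its cube, whose image is then both nonnegative and
  -- nonpositive.
  have h1 : x⁻ * x * x⁻ = -(x⁻ * x⁻ * x⁻) := by rw [negPart_mul_self hx, neg_mul]
  have h2 : 0 ≤ ρ (x⁻ * x * x⁻) := by
    rw [map_mul, map_mul]
    exact IsSelfAdjoint.conjugate_nonneg h (h0.isSelfAdjoint.map ρ)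
  have h3 : 0 ≤ x⁻ * x⁻ * x⁻ := IsSelfAdjoint.conjugate_nonneg h0 h0.isSelfAdjoint
  have h4 : 0 ≤ ρ (x⁻ * x⁻ * x⁻) := by
    rw [map_mul, map_mul]
    exact IsSelfAdjoint.conjugate_nonneg (map_nonneg ρ h0) (h0.isSelfAdjoint.map ρ)
  rw [h1, map_neg] at h2
  have h5 : x⁻ * x⁻ * x⁻ = 0 := hρ (by
    rw [map_zero]; exact le_antisymm (neg_nonneg.mp h2) h4)
  have h6 : (x⁻ * x⁻) * (x⁻ * x⁻) = 0 := by rw [← mul_assoc, h5, zero_mul]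
  have h7 : x⁻ * x⁻ = 0 := by
    refine CStarRing.star_mul_self_eq_zero_iff _ |>.mp ?_
    rw [star_mul, h0.isSelfAdjoint.star_eq, h6]
  refine CStarRing.star_mul_self_eq_zero_iff _ |>.mp ?_
  rw [h0.isSelfAdjoint.star_eq, h7]

/-- Heuristically, `p` or `q` vanishes at each point, so one of the two inequalities gives `x ≥ 0`
there. Algebraically, multiply both by `x⁻`: conjugating the first by `q` removes `p` and forces `x⁻
* q = 0`, and the second then forces `x⁻ = 0`. -/
theorem nonneg_of_add_nonneg_of_mul_eq_zero {x p q : B} (hx : IsSelfAdjoint x)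
    (hq : IsSelfAdjoint q) (hxp : Commute x p) (hxq : Commute x q)
    (hpq : p * q = 0) (h1 : 0 ≤ x + p) (h2 : 0 ≤ x + q) : 0 ≤ x := by
  refine nonneg_of_negPart_eq_zero hx ?_
  have h0 : 0 ≤ x⁻ := CFC.negPart_nonneg x
  have hnx : Commute x⁻ x := (Commute.refl x).cfcₙ_real _
  have hnp : Commute x⁻ p := hxp.cfcₙ_real _
  have hnq : Commute x⁻ q := hxq.cfcₙ_real _
  have hnn := negPart_mul_self hx
  have key1 := Commute.mul_nonneg h0 h1 (hnx.add_right hnp)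
  have key2 := Commute.mul_nonneg h0 h2 (hnx.add_right hnq)
  rw [mul_add, hnn] at key1 key2
  have hz : x⁻ * q = 0 := by
    have := IsSelfAdjoint.conjugate_nonneg key1 hq
    rw [mul_add, add_mul, mul_assoc q (x⁻ * p) q, mul_assoc x⁻ p q, hpq, mul_zero, mul_zero,
      add_zero, mul_neg, neg_mul, neg_nonneg] at this
    have h3 : q * (x⁻ * x⁻) * q = star (x⁻ * q) * (x⁻ * q) := by
      rw [star_mul, hq.star_eq, h0.isSelfAdjoint.star_eq]; simp only [mul_assoc]
    rw [h3] at this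
    exact CStarRing.star_mul_self_eq_zero_iff _ |>.mp
      (le_antisymm this (star_mul_self_nonneg _))
  rw [hz, add_zero, neg_nonneg] at key2
  refine CStarRing.star_mul_self_eq_zero_iff _ |>.mp ?_
  refine le_antisymm ?_ (star_mul_self_nonneg _)
  rwa [h0.isSelfAdjoint.star_eq]

/-- Truncating the larger of two commuting self-adjoint elements at the norm of the smaller one
gives an element between the two. -/
theorem cfc_truncate_between {a b : B} (ha : IsSelfAdjoint a) (hb : IsSelfAdjoint b)
    (hab : Commute a b) (h : a ≤ b) :
    a ≤ cfc (fun t : ℝ => max (-‖a‖) (min t ‖a‖)) b ∧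
      cfc (fun t : ℝ => max (-‖a‖) (min t ‖a‖)) b ≤ b ∧
      ‖cfc (fun t : ℝ => max (-‖a‖) (min t ‖a‖)) b‖ ≤ ‖a‖ := by
  set c := ‖a‖ with hc
  have hc0 : 0 ≤ c := norm_nonneg a
  set f : ℝ → ℝ := fun t => max (-c) (min t c) with hf
  have hfc : Continuous f := by fun_prop
  have hspec : ∀ t ∈ spectrum ℝ b, -c ≤ t := by
    have : algebraMap ℝ B (-c) ≤ b := by
      rw [map_neg]; exact (IsSelfAdjoint.neg_algebraMap_norm_le_self ha).trans h
    exact (algebraMap_le_iff_le_spectrum hb).mp this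
  have hp : b - cfc f b = cfc (fun t => t - f t) b := by
    rw [cfc_sub _ _ b, cfc_id' ℝ b]
  have hq : algebraMap ℝ B c - cfc f b = cfc (fun t => c - f t) b := by
    rw [cfc_sub _ _ b, cfc_const c b]
  have hp0 : 0 ≤ b - cfc f b := by
    rw [hp]; refine cfc_nonneg fun t ht => ?_
    have := hspec t ht
    simp only [hf, sub_nonneg, max_le_iff]; exact ⟨this, min_le_left _ _⟩
  refine ⟨?_, sub_nonneg.mp hp0, ?_⟩
  · have hfa : Commute (cfc f b) a := hab.symm.cfc_real f
    rw [← sub_nonneg]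
    have hfs : IsSelfAdjoint (cfc f b) := cfc_predicate f b
    -- The two sums are `b - a` and `c - a`, and `p * q = 0` because `min t c` is always `t` or `c`.
    refine nonneg_of_add_nonneg_of_mul_eq_zero (p := b - cfc f b)
      (q := algebraMap ℝ B c - cfc f b) (hfs.sub ha)
      ((IsSelfAdjoint.algebraMap B (.all c)).sub hfs) ?_ ?_ ?_ ?_ ?_
    · have h1 : Commute (cfc f b) b := (Commute.refl b).cfc_real f
      exact ((h1.sub_right (Commute.refl _))).sub_left (hab.sub_right hfa.symm)
    · exact Commute.sub_right (Algebra.commutes c _).symm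
        ((Commute.refl _).sub_left hfa.symm)
    · rw [hp, hq, ← cfc_mul _ _ b, ← cfc_zero ℝ b]
      refine cfc_congr fun t ht => ?_
      have := hspec t ht
      simp only [hf, Pi.zero_apply]
      rcases le_total t c with h1 | h1
      · rw [min_eq_left h1, max_eq_right this]; ring
      · rw [min_eq_right h1, max_eq_right (by linarith)]; ring
    · have : cfc f b - a + (b - cfc f b) = b - a := by abel
      rw [this]; exact sub_nonneg.mpr h
    · have : cfc f b - a + (algebraMap ℝ B c - cfc f b) = algebraMap ℝ B c - a := by abel
      rw [this]; exact sub_nonneg.mpr (IsSelfAdjoint.le_algebraMap_norm_self ha)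
  · refine norm_cfc_le hc0 fun t _ => ?_
    rw [Real.norm_eq_abs, abs_le]
    exact ⟨le_max_left _ _, max_le (by linarith) (min_le_right _ _)⟩

theorem map_realPart_of_isSelfAdjoint {A : Type*} [CStarAlgebra A] {B : Type*} [CStarAlgebra B]
    (π : A →⋆ₐ[ℂ] B) {b : A} (hb : IsSelfAdjoint (π b)) : π (realPart b : A) = π b := by
  have h : (realPart b : A) = (2⁻¹ : ℂ) • (b + star b) := by
    rw [realPart_apply_coe, ← Complex.coe_smul]; norm_num
  rw [h, map_smul, map_add, map_star, hb.star_eq, ← two_smul ℂ (π b), smul_smul]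
  norm_num

/-- Commuting pairs, the second of which is the range of a `*`-homomorphism, are unperforated. -/
theorem isUnperforated_of_commute {A : Type*} [CStarAlgebra A] {B : Type*} [CStarAlgebra B]
    [PartialOrder B] [StarOrderedRing B] (X : Submodule ℂ B) (π : A →⋆ₐ[ℂ] B)
    (h : ∀ x ∈ X, ∀ y ∈ LinearMap.range π.toAlgHom.toLinearMap, Commute x y) :
    IsUnperforated X (LinearMap.range π.toAlgHom.toLinearMap) := by
  rintro a haX ha _ ⟨b, rfl⟩ hb hab
  change IsSelfAdjoint (π b) at hb
  change a ≤ π b at hab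
  have hbb := map_realPart_of_isSelfAdjoint π hb
  obtain ⟨h1, h2, h3⟩ := cfc_truncate_between ha hb (h a haX _ ⟨b, rfl⟩) hab
  -- The truncation stays in the range because `π` commutes with the functional calculus of a
  -- self-adjoint lift.
  refine ⟨_, ⟨cfc (fun t : ℝ => max (-‖a‖) (min t ‖a‖)) (realPart b : A), ?_⟩,
    cfc_predicate _ _, h3, h1, h2⟩
  have hfc : Continuous (fun t : ℝ => max (-‖a‖) (min t ‖a‖)) := by fun_prop
  have := StarAlgHomClass.map_cfc (S := ℂ) π (fun t : ℝ => max (-‖a‖) (min t ‖a‖))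
    (realPart b : A) hfc.continuousOn (map_continuous π) (realPart b).2 (by rw [hbb]; exact hb)
  rw [hbb] at this
  exact this

end Order

/-! ### Compressions of completely positive maps -/

section Compression

open ContinuousLinearMap

variable {L : Type*} [NormedAddCommGroup L] [InnerProductSpace ℂ L] [CompleteSpace L]
  {M : Type*} [NormedAddCommGroup M] [InnerProductSpace ℂ M] [CompleteSpace M]

theorem adjoint_apply_self (V : L →L[ℂ] M) (hV : adjoint V ∘L V = 1) (x : L) :
    adjoint V (V x) = x := congrArg (· x) hV

/-- The embedding `T ↦ V T V*` of `B(L)` into `B(M)` given by an isometry `V : L → M`. -/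
noncomputable def conjIsometry (V : L →L[ℂ] M) (hV : adjoint V ∘L V = 1) :
    (L →L[ℂ] L) →⋆ₙₐ[ℂ] (M →L[ℂ] M) where
  toFun T := V ∘L T ∘L adjoint V
  map_smul' c T := by ext; simp
  map_zero' := by ext; simp
  map_add' S T := by ext; simp
  map_mul' S T := by ext; simp [adjoint_apply_self V hV]
  map_star' T := by simp [star_eq_adjoint, adjoint_comp, comp_assoc]

theorem conjIsometry_injective (V : L →L[ℂ] M) (hV : adjoint V ∘L V = 1) :
    Function.Injective (conjIsometry V hV) := by
  intro S T h
  ext x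
  have := congrArg (fun R : M →L[ℂ] M => adjoint V (R (V x))) h
  simpa [conjIsometry, adjoint_apply_self V hV] using this

/-- Applying the injective homomorphism `T ↦ V T V*` entrywise turns the compressed matrix into `D *
P * D`, with `D` the diagonal matrix of the projection `V V*`. Positivity is reflected back along
it. -/
theorem CStarMatrix.map_compression_nonneg {k : ℕ} (V : L →L[ℂ] M) (hV : adjoint V ∘L V = 1)
    {P : CStarMatrix (Fin k) (Fin k) (M →L[ℂ] M)} (hP : 0 ≤ P) :
    0 ≤ P.map (fun T => adjoint V ∘L T ∘L V) := by
  refine nonneg_of_map_nonneg (CStarMatrix.mapₙₐ (conjIsometry V hV))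
    (CStarMatrix.map_injective (conjIsometry_injective V hV)) ?_
  set D : CStarMatrix (Fin k) (Fin k) (M →L[ℂ] M) :=
    CStarMatrix.ofMatrix (Matrix.diagonal fun _ => V ∘L adjoint V) with hD
  have hDs : IsSelfAdjoint D := by
    refine CStarMatrix.ext fun i j => ?_
    change star (Matrix.diagonal (fun _ => V ∘L adjoint V) j i) = Matrix.diagonal _ i j
    rcases eq_or_ne i j with rfl | h
    · simp [star_eq_adjoint, adjoint_comp]
    · simp [Matrix.diagonal_apply_ne _ h, Matrix.diagonal_apply_ne _ h.symm]
  have : CStarMatrix.mapₙₐ (conjIsometry V hV) (P.map (fun T => adjoint V ∘L T ∘L V))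
      = D * P * D := by
    have hm (e : M →L[ℂ] M) (Q : Matrix (Fin k) (Fin k) (M →L[ℂ] M)) (i j : Fin k) :
        (Matrix.diagonal (fun _ => e) * Q * Matrix.diagonal (fun _ => e) :
          Matrix (Fin k) (Fin k) (M →L[ℂ] M)) i j = e * Q i j * e := by
      rw [Matrix.mul_diagonal, Matrix.diagonal_mul]
    exact CStarMatrix.ext fun i j => (hm (V ∘L adjoint V) P i j).symm
  rw [this]
  exact IsSelfAdjoint.conjugate_nonneg hP hDs

/-- The completely positive map `a ↦ V* τ(Φ(a)) V`. -/
noncomputable def CompletelyPositiveMap.compression {A : Type*} [CStarAlgebra A] [PartialOrder A]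
    [StarOrderedRing A] {B : Type*} [CStarAlgebra B] [PartialOrder B] [StarOrderedRing B]
    (Φ : A →CP B) (τ : B →⋆ₐ[ℂ] (M →L[ℂ] M)) (V : L →L[ℂ] M) (hV : adjoint V ∘L V = 1) :
    A →CP (L →L[ℂ] L) where
  toFun a := adjoint V ∘L τ (Φ a) ∘L V
  map_add' a b := by ext; simp
  map_smul' c a := by ext; simp
  map_cstarMatrix_nonneg' k N hN :=
    CStarMatrix.map_compression_nonneg V hV
      (CompletelyPositiveMapClass.map_cstarMatrix_nonneg' τ k _
        (CompletelyPositiveMapClass.map_cstarMatrix_nonneg' Φ k N hN))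

theorem CompletelyPositiveMap.compression_apply {A : Type*} [CStarAlgebra A] [PartialOrder A]
    [StarOrderedRing A] {B : Type*} [CStarAlgebra B] [PartialOrder B] [StarOrderedRing B]
    (Φ : A →CP B) (τ : B →⋆ₐ[ℂ] (M →L[ℂ] M)) (V : L →L[ℂ] M) (hV : adjoint V ∘L V = 1) (a : A) :
    Φ.compression τ V hV a = adjoint V ∘L τ (Φ a) ∘L V := rfl

end Compression

/-! ### GNS representations: irreducibility and functoriality -/

namespace PositiveLinearMap

open scoped ComplexOrder InnerProductSpace
open UniformSpace Completion ContinuousLinearMap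

variable {A : Type*} [CStarAlgebra A] [PartialOrder A] [StarOrderedRing A] (f : A →ₚ[ℂ] ℂ)

/-- The canonical cyclic vector of the GNS representation. -/
noncomputable def gnsVector : f.GNS := (f.toPreGNS 1 : f.PreGNS)

theorem gnsStarAlgHom_gnsVector (a : A) :
    f.gnsStarAlgHom a f.gnsVector = (f.toPreGNS a : f.PreGNS) := by
  change f.gnsNonUnitalStarAlgHom a f.gnsVector = _
  rw [gnsVector, gnsNonUnitalStarAlgHom_apply_coe]
  simp

theorem dense_gnsStarAlgHom_gnsVector :
    DenseRange fun a => f.gnsStarAlgHom a f.gnsVector := by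
  simp_rw [gnsStarAlgHom_gnsVector]
  exact (denseRange_coe (α := f.PreGNS)).comp f.toPreGNS.surjective.denseRange (continuous_coe _)

theorem inner_gnsVector (a : A) : ⟪f.gnsVector, f.gnsStarAlgHom a f.gnsVector⟫_ℂ = f a := by
  rw [gnsStarAlgHom_gnsVector, gnsVector, inner_coe, preGNS_inner_def]
  simp

theorem inner_gnsStarAlgHom_right (a : A) (x y : f.GNS) :
    ⟪x, f.gnsStarAlgHom a y⟫_ℂ = ⟪f.gnsStarAlgHom (star a) x, y⟫_ℂ := by
  rw [map_star, star_eq_adjoint, adjoint_inner_left]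

/-- The GNS representation is irreducible if its vector functionals dominated by the given state
are multiples of it. -/
theorem isIrreducibleRep_gnsStarAlgHom (h1 : f 1 = 1)
    (hpure : ∀ η η' : f.GNS, (∀ a, f a = ⟪η, f.gnsStarAlgHom a η⟫_ℂ + ⟪η', f.gnsStarAlgHom a η'⟫_ℂ) →
      ∀ a, ⟪η, f.gnsStarAlgHom a η⟫_ℂ = (‖η‖ : ℂ) ^ 2 * f a) :
    IsIrreducibleRep f.gnsStarAlgHom := by
  have hξ0 : f.gnsVector ≠ 0 := by
    intro h
    have := f.inner_gnsVector 1
    rw [h, inner_zero_left, h1] at this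
    exact zero_ne_one this
  refine ⟨⟨⟨f.gnsVector, 0, hξ0⟩⟩, fun W hW hinv => ?_⟩
  have : CompleteSpace W := hW.completeSpace_coe
  set ξ := f.gnsVector
  -- By invariance of `W`, projecting `ξ` onto it splits the state into the vector functionals of
  -- `η` and `ξ - η`. Purity and cyclicity give `η = ‖η‖² ξ`. Projecting again leaves `η = 0` or
  -- `‖η‖² = 1`, that is, `W = ⊥` or `ξ ∈ W`.
  set η : f.GNS := W.starProjection ξ with hη
  have hηW : η ∈ W := W.starProjection_apply_mem ξ
  have hη' : ∀ w ∈ W, ⟪w, ξ - η⟫_ℂ = 0 := fun w hw =>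
    W.sub_starProjection_mem_orthogonal ξ w hw
  have hη'' : ∀ w ∈ W, ⟪ξ - η, w⟫_ℂ = 0 := fun w hw => by
    rw [← inner_conj_symm, hη' w hw, map_zero]
  have e1 : ∀ a, ⟪ξ, f.gnsStarAlgHom a η⟫_ℂ = ⟪η, f.gnsStarAlgHom a η⟫_ℂ := fun a => by
    have := hη'' _ (hinv a η hηW)
    rwa [inner_sub_left, sub_eq_zero] at this
  have e2 : ∀ a, ⟪η, f.gnsStarAlgHom a (ξ - η)⟫_ℂ = 0 := fun a => by
    rw [inner_gnsStarAlgHom_right]; exact hη' _ (hinv _ _ hηW)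
  have key := hpure η (ξ - η) fun a => by
    rw [← f.inner_gnsVector a]
    change ⟪ξ, f.gnsStarAlgHom a ξ⟫_ℂ = _
    have h2 := e2 a
    rw [map_sub, inner_sub_right, sub_eq_zero] at h2
    rw [map_sub, inner_sub_right, inner_sub_left, inner_sub_left, e1, h2]
    ring
  have hηξ : η = ((‖η‖ : ℂ) ^ 2) • ξ := by
    rw [← sub_eq_zero]
    refine f.dense_gnsStarAlgHom_gnsVector.eq_zero_of_inner_left (𝕜 := ℂ) fun a => ?_
    change ⟪_, f.gnsStarAlgHom a ξ⟫_ℂ = 0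
    have h2 := e2 a
    rw [map_sub, inner_sub_right, sub_eq_zero] at h2
    rw [inner_sub_left, h2, key, inner_smul_left, ← f.inner_gnsVector a]
    simp [ξ]
  have hPη : W.starProjection η = η := W.starProjection_eq_self_iff.mpr hηW
  by_cases h0 : η = 0
  · left
    rw [Submodule.eq_bot_iff]
    intro w hw
    refine f.dense_gnsStarAlgHom_gnsVector.eq_zero_of_inner_left (𝕜 := ℂ) fun a => ?_
    change ⟪_, f.gnsStarAlgHom a ξ⟫_ℂ = 0
    rw [inner_gnsStarAlgHom_right]
    simpa [h0] using hη' _ (hinv (star a) w hw)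
  · right
    have ht : ((‖η‖ : ℂ) ^ 2) = 1 := by
      have h2 : η = ((‖η‖ : ℂ) ^ 2) • η := by
        conv_lhs => rw [← hPη, hηξ, map_smul]
      have h3 : (1 - (‖η‖ : ℂ) ^ 2) • η = 0 := by
        rw [sub_smul, one_smul, ← h2, sub_self]
      rcases smul_eq_zero.mp h3 with h | h
      · exact (sub_eq_zero.mp h).symm
      · exact absurd h h0
    have hξW : ξ ∈ W := by rw [ht, one_smul] at hηξ; rwa [← hηξ]
    rw [eq_top_iff]
    rintro x -
    exact hW.closure_subset_iff.mpr (by rintro _ ⟨a, rfl⟩; exact hinv a _ hξW)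
      (f.dense_gnsStarAlgHom_gnsVector x)

section Functoriality

variable {B : Type*} [CStarAlgebra B] [PartialOrder B] [StarOrderedRing B] {f}
  {ψ : B →ₚ[ℂ] ℂ} (π : A →⋆ₐ[ℂ] B) (hf : ∀ a, f a = ψ (π a))

/-- The map of pre-GNS spaces induced by a `*`-homomorphism preserving positive functionals. -/
noncomputable def preGNSMap : f.PreGNS →ₗᵢ[ℂ] ψ.PreGNS where
  toLinearMap := ψ.toPreGNS.toLinearMap ∘ₗ π.toAlgHom.toLinearMap ∘ₗ f.ofPreGNS.toLinearMap
  norm_map' x := by simp [preGNS_norm_def, hf, map_star π]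

/-- The isometry of GNS spaces induced by a `*`-homomorphism preserving positive functionals. -/
noncomputable def gnsMap : f.GNS →L[ℂ] ψ.GNS :=
  (preGNSMap π hf).toContinuousLinearMap.completion

theorem gnsMap_coe (x : f.PreGNS) :
    gnsMap π hf x = (ψ.toPreGNS (π (f.ofPreGNS x)) : ψ.PreGNS) := by
  simp only [gnsMap, completion_apply_coe]
  rfl

theorem adjoint_gnsMap_comp_gnsMap : adjoint (gnsMap π hf) ∘L gnsMap π hf = 1 := by
  refine (norm_map_iff_adjoint_comp_self _).mp fun x => ?_
  induction x using induction_on with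
  | hp => exact isClosed_eq (by fun_prop) (by fun_prop)
  | ih x =>
    rw [gnsMap_coe, norm_coe, norm_coe]
    exact (preGNSMap π hf).norm_map x

theorem gnsMap_gnsVector : gnsMap π hf f.gnsVector = ψ.gnsVector := by
  rw [gnsVector, gnsMap_coe, ofPreGNS_toPreGNS, map_one, gnsVector]

theorem gnsMap_gnsStarAlgHom (a : A) (x : f.GNS) :
    gnsMap π hf (f.gnsStarAlgHom a x) = ψ.gnsStarAlgHom (π a) (gnsMap π hf x) := by
  induction x using induction_on with
  | hp => exact isClosed_eq (by fun_prop) (by fun_prop)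
  | ih x =>
    change gnsMap π hf (f.gnsNonUnitalStarAlgHom a x) =
      ψ.gnsNonUnitalStarAlgHom (π a) (gnsMap π hf x)
    simp [gnsMap_coe]

/-- The bound by `‖π a‖` rather than `‖a‖` is what shows that vector states of this representation
factor through `π`. It holds because `gnsMap` is isometric and intertwines with a representation of
`B`. -/
theorem norm_gnsStarAlgHom_le (hf : ∀ a, f a = ψ (π a)) (a : A) (x : f.GNS) :
    ‖f.gnsStarAlgHom a x‖ ≤ ‖π a‖ * ‖x‖ := by
  have hV := (norm_map_iff_adjoint_comp_self (gnsMap π hf)).mpr (adjoint_gnsMap_comp_gnsMap π hf)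
  rw [← hV (f.gnsStarAlgHom a x), gnsMap_gnsStarAlgHom, ← hV x]
  refine (ContinuousLinearMap.le_opNorm _ _).trans ?_
  gcongr
  exact NonUnitalStarAlgHom.norm_apply_le _ _

end Functoriality

end PositiveLinearMap

/-! ### States factoring through `π` and their extensions -/

section DominatedStates

open scoped ComplexOrder InnerProductSpace

variable {A : Type*} [CStarAlgebra A] {B : Type*} [CStarAlgebra B] (π : A →⋆ₐ[ℂ] B)

theorem StarAlgHom.map_real_smul (c : ℝ) (x : A) : π (c • x) = c • π x := by
  rw [← Complex.coe_smul, map_smul, Complex.coe_smul]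

/-- The real parts of the states of `A` that factor through `π`. -/
def factoringStates : Set (WeakDual ℝ A) :=
  {f | f 1 = 1 ∧ (∀ x, f x ≤ ‖π x‖) ∧ ∀ x, f (star x) = f x}

variable {π}

theorem abs_le_of_le_norm_map (f : A →ₗ[ℝ] ℝ) (h : ∀ x, f x ≤ ‖π x‖) (x : A) : |f x| ≤ ‖x‖ := by
  have hπ : ‖π x‖ ≤ ‖x‖ := NonUnitalStarAlgHom.norm_apply_le π x
  refine abs_le.mpr ⟨?_, (h x).trans hπ⟩
  have := h (-x)
  rw [map_neg, map_neg, norm_neg] at this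
  linarith

theorem exists_mem_factoringStates (l : A →ₗ[ℝ] ℝ) (h1 : l 1 = 1) (h2 : ∀ x, l x ≤ ‖π x‖)
    (h3 : ∀ x, l (star x) = l x) : ∃ f ∈ factoringStates π, ∀ x, f x = l x :=
  ⟨StrongDual.toWeakDual (l.mkContinuous 1 fun x => by
    simpa using abs_le_of_le_norm_map l h2 x), ⟨h1, h2, h3⟩, fun _ => rfl⟩

variable (π) in
theorem isClosed_factoringStates : IsClosed (factoringStates π) := by
  have e (x : A) : Continuous fun f : WeakDual ℝ A => f x := WeakDual.eval_continuous x
  have h : factoringStates π = {f | f 1 = 1} ∩ ((⋂ x, {f | f x ≤ ‖π x‖}) ∩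
      ⋂ x, {f | f (star x) = f x}) := by
    ext f; simp [factoringStates]
  rw [h]
  exact (isClosed_eq (e 1) continuous_const).inter
    ((isClosed_iInter fun x => isClosed_le (e x) continuous_const).inter
      (isClosed_iInter fun x => isClosed_eq (e _) (e x)))

variable (π) in
theorem isCompact_factoringStates : IsCompact (factoringStates π) := by
  refine (WeakDual.isCompact_closedBall (𝕜 := ℝ) (E := A) 0 1).of_isClosed_subset
    (isClosed_factoringStates π) fun f hf => ?_
  rw [Set.mem_preimage, mem_closedBall_zero_iff]
  refine ContinuousLinearMap.opNorm_le_bound _ zero_le_one fun x => ?_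
  rw [one_mul]
  exact abs_le_of_le_norm_map (WeakDual.toStrongDual f).toLinearMap hf.2.1 x

variable [PartialOrder B] [StarOrderedRing B]

/-- A functional bounded by the norm and equal to `1` at the unit is positive: for `y ≥ 0` one has
`‖‖y‖ - y‖ ≤ ‖y‖`. -/
theorem factoringStates.nonneg {f : WeakDual ℝ A} (hf : f ∈ factoringStates π) {x : A}
    (hx : 0 ≤ π x) : 0 ≤ f x := by
  have h1 : ‖algebraMap ℝ B ‖π x‖ - π x‖ ≤ ‖π x‖ := by
    rw [CStarAlgebra.norm_le_iff_le_algebraMap _ (norm_nonneg _)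
      (sub_nonneg.mpr (IsSelfAdjoint.le_algebraMap_norm_self hx.isSelfAdjoint))]
    exact sub_le_self _ hx
  have h2 := hf.2.1 (‖π x‖ • (1 : A) - x)
  rw [map_sub, map_sub, map_smul, hf.1, StarAlgHom.map_real_smul, map_one,
    ← Algebra.algebraMap_eq_smul_one (A := B), smul_eq_mul, mul_one] at h2
  linarith

theorem factoringStates.mono {f : WeakDual ℝ A} (hf : f ∈ factoringStates π) {x y : A}
    (h : π x ≤ π y) : f x ≤ f y := by
  have := factoringStates.nonneg hf (x := y - x) (by rwa [map_sub, sub_nonneg])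
  rwa [map_sub, sub_nonneg] at this

variable (π) in
/-- The values of a functional on the elements whose image dominates `x`. -/
def dominatingValues (f : WeakDual ℝ A) (x : B) : Set ℝ :=
  f '' {b | x + star x ≤ π b + star (π b)}

theorem factoringStates.neg_norm_le {f : WeakDual ℝ A} (hf : f ∈ factoringStates π) {x : B}
    {b : A} (h : x + star x ≤ π b + star (π b)) : -‖x + star x‖ ≤ 2 * f b := by
  have h1 : algebraMap ℝ B (-‖x + star x‖) ≤ x + star x := by
    rw [map_neg]; exact IsSelfAdjoint.neg_algebraMap_norm_le_self (.add_star_self x)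
  have h2 := factoringStates.mono hf (x := (-‖x + star x‖) • (1 : A)) (y := b + star b) (by
    rw [StarAlgHom.map_real_smul, map_one, ← Algebra.algebraMap_eq_smul_one, map_add, map_star]
    exact h1.trans h)
  rw [map_smul, hf.1, map_add, hf.2.2, smul_eq_mul, mul_one] at h2
  linarith

theorem bddBelow_dominatingValues {f : WeakDual ℝ A} (hf : f ∈ factoringStates π) (x : B) :
    BddBelow (dominatingValues π f x) := by
  refine ⟨-‖x + star x‖ / 2, ?_⟩
  rintro _ ⟨b, hb, rfl⟩
  have := factoringStates.neg_norm_le hf hb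
  linarith

variable (π) in
theorem nonempty_dominatingValues (f : WeakDual ℝ A) (x : B) :
    (dominatingValues π f x).Nonempty := by
  refine ⟨_, ‖x + star x‖ • 1, ?_, rfl⟩
  rw [Set.mem_ofPred, StarAlgHom.map_real_smul, map_one, ← Algebra.algebraMap_eq_smul_one]
  have h := IsSelfAdjoint.le_algebraMap_norm_self (IsSelfAdjoint.add_star_self x)
  have h0 : (0 : B) ≤ algebraMap ℝ B ‖x + star x‖ := algebraMap_nonneg B (norm_nonneg _)
  rw [h0.isSelfAdjoint.star_eq]
  exact h.trans (le_add_of_nonneg_left h0)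

/-- Subadditivity and positive homogeneity make this infimum the sublinear majorant for Hahn–Banach.
Comparing only real parts defines it on all of `B` as a real vector space. -/
theorem sInf_dominatingValues_add_le {f : WeakDual ℝ A} (hf : f ∈ factoringStates π) (x y : B) :
    sInf (dominatingValues π f (x + y)) ≤
      sInf (dominatingValues π f x) + sInf (dominatingValues π f y) := by
  rw [← sub_le_iff_le_add]
  refine le_csInf (nonempty_dominatingValues π f x) ?_
  rintro _ ⟨b, hb, rfl⟩
  rw [sub_le_comm]
  refine le_csInf (nonempty_dominatingValues π f y) ?_
  rintro _ ⟨c, hc, rfl⟩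
  rw [sub_le_iff_le_add']
  refine csInf_le (bddBelow_dominatingValues hf _) ⟨b + c, ?_, map_add f b c⟩
  rw [Set.mem_ofPred] at hb hc ⊢
  rw [map_add, star_add, star_add, add_add_add_comm, add_add_add_comm (π b)]
  exact add_le_add hb hc

theorem sInf_dominatingValues_smul_le {f : WeakDual ℝ A} (hf : f ∈ factoringStates π) {c : ℝ}
    (hc : 0 < c) (x : B) :
    sInf (dominatingValues π f (c • x)) ≤ c * sInf (dominatingValues π f x) := by
  rw [← div_le_iff₀' hc]
  refine le_csInf (nonempty_dominatingValues π f x) ?_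
  rintro _ ⟨b, hb, rfl⟩
  rw [div_le_iff₀' hc]
  refine csInf_le (bddBelow_dominatingValues hf _) ⟨c • b, ?_, map_smul f c b⟩
  rw [Set.mem_ofPred] at hb ⊢
  rw [StarAlgHom.map_real_smul, star_smul, star_smul, star_trivial, ← smul_add, ← smul_add]
  exact smul_le_smul_of_nonneg_left hb hc.le

theorem sInf_dominatingValues_smul {f : WeakDual ℝ A} (hf : f ∈ factoringStates π) (c : ℝ)
    (hc : 0 < c) (x : B) :
    sInf (dominatingValues π f (c • x)) = c * sInf (dominatingValues π f x) := by
  refine (sInf_dominatingValues_smul_le hf hc x).antisymm ?_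
  have := sInf_dominatingValues_smul_le hf (inv_pos.mpr hc) (c • x)
  rwa [smul_smul, inv_mul_cancel₀ hc.ne', one_smul, ← div_eq_inv_mul, le_div_iff₀' hc] at this

/-- A state of `A` that factors through `π` extends to a state of `B` which is as large at `a` as
the elements of the range of `π` dominating `a` permit. -/
theorem exists_positive_extension {f : WeakDual ℝ A} (hf : f ∈ factoringStates π) {a : B}
    (ha : a ≠ 0) {r : ℝ} (h : ∀ b : A, a + star a ≤ π b + star (π b) → r ≤ f b) :
    ∃ ψ : B →ₚ[ℂ] ℂ, (∀ x, (ψ (π x)).re = f x) ∧ r ≤ (ψ a).re := by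
  set N : B → ℝ := fun x => sInf (dominatingValues π f x) with hN
  have N_hom := sInf_dominatingValues_smul hf
  have N_add := sInf_dominatingValues_add_le hf
  have N_zero : N 0 = 0 := by
    have := N_hom 2 two_pos 0
    rw [smul_zero] at this
    change N 0 = 2 * N 0 at this
    linarith
  have N_le (x : B) (b : A) (hb : x + star x ≤ π b + star (π b)) : N x ≤ f b :=
    csInf_le (bddBelow_dominatingValues hf _) ⟨b, hb, rfl⟩
  obtain ⟨g, hg1, hg2⟩ := exists_extension_of_le_sublinear
    (LinearPMap.mkSpanSingleton (K := ℝ) a (N a) ha) N N_hom N_add (by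
      rintro ⟨x, hx⟩
      obtain ⟨t, rfl⟩ := Submodule.mem_span_singleton.mp hx
      have hv : LinearPMap.mkSpanSingleton (K := ℝ) a (N a) ha ⟨t • a, hx⟩ = t • N a :=
        LinearPMap.mkSpanSingleton'_apply _ _ _ _ _
      rw [hv]
      rcases lt_trichotomy t 0 with ht | rfl | ht
      · have h1 := N_hom (-t) (neg_pos.mpr ht) a
        have h2 := N_add (t • a) ((-t) • a)
        rw [← add_smul, add_neg_cancel, zero_smul] at h2
        change N 0 ≤ _ at h2
        rw [N_zero, h1] at h2
        simp only [smul_eq_mul]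
        linarith
      · simp [N_zero]
      · exact (N_hom t ht a).ge)
  have hga : g a = N a := by
    have := hg1 ⟨a, Submodule.mem_span_singleton_self a⟩
    exact this.trans (LinearPMap.mkSpanSingleton_apply ℝ ℝ ha (N a))
  -- The element `x` itself dominates `π x`, and `-x` dominates `-π x`, so the majorant pins `g ∘ π`
  -- to `f`.
  have hgπ (x : A) : g (π x) = f x := by
    refine le_antisymm ((hg2 _).trans (N_le _ x le_rfl)) ?_
    have := (hg2 (π (-x))).trans (N_le _ (-x) le_rfl)
    rw [map_neg, map_neg, map_neg] at this
    linarith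
  have hgneg (x : B) (hx : x + star x ≤ 0) : g x ≤ 0 := by
    have := (hg2 x).trans (N_le x 0 (by simpa using hx))
    rwa [map_zero] at this
  have hpos (x : B) (hx : 0 ≤ x) : 0 ≤ Module.Dual.extendRCLike (𝕜 := ℂ) g x := by
    have h1 := hgneg (-x) (by
      rw [star_neg, ← neg_add, neg_nonpos, hx.isSelfAdjoint.star_eq]
      exact add_nonneg hx hx)
    -- For `x ≥ 0` the real part of `i x` vanishes, so `g (i x) = 0` and the complexification of `g`
    -- is real at `x`.
    have hI : Complex.I • x + star (Complex.I • x) = 0 := by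
      rw [star_smul, hx.isSelfAdjoint.star_eq]; simp
    have h2 := hgneg (Complex.I • x) hI.le
    have h3 := hgneg (-(Complex.I • x)) (by rw [star_neg, ← neg_add, hI, neg_zero])
    rw [map_neg] at h1 h3
    have h4 : g (Complex.I • x) = 0 := by linarith
    rw [Complex.nonneg_iff]
    constructor
    · have := Module.Dual.re_extendRCLike_apply (𝕜 := ℂ) g x
      simp only [RCLike.re_to_complex] at this
      rw [this]; linarith
    · have := Module.Dual.im_extendRCLike_apply (𝕜 := ℂ) g x
      simp only [RCLike.im_to_complex, RCLike.I_to_complex] at this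
      rw [this, h4, neg_zero]
  refine ⟨PositiveLinearMap.mk₀ (Module.Dual.extendRCLike (𝕜 := ℂ) g) hpos, fun x => ?_, ?_⟩
  · exact (Module.Dual.re_extendRCLike_apply (𝕜 := ℂ) g (π x)).trans (hgπ x)
  · have h1 : (PositiveLinearMap.mk₀ (Module.Dual.extendRCLike (𝕜 := ℂ) g) hpos a).re = g a :=
      Module.Dual.re_extendRCLike_apply (𝕜 := ℂ) g a
    rw [h1, hga]
    refine le_csInf (nonempty_dominatingValues π f a) ?_
    rintro _ ⟨b, hb, rfl⟩
    exact h b hb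

end DominatedStates

/-! ### Faces, pure states and unique extension -/

section ExtremeStates

open scoped ComplexOrder InnerProductSpace

variable {A : Type*} [CStarAlgebra A] {B : Type*} [CStarAlgebra B] [PartialOrder B] {π : A →⋆ₐ[ℂ] B}

theorem norm_add_norm_of_mem_spectrum {B : Type*} [CStarAlgebra B] [Nontrivial B] {a : B}
    (h : ‖a‖ ∈ spectrum ℝ a) : ‖algebraMap ℝ B ‖a‖ + a‖ = ‖a‖ + ‖a‖ := by
  refine le_antisymm ?_ ?_
  · refine (norm_add_le _ _).trans ?_
    rw [norm_algebraMap', norm_norm]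
  · have := spectrum.norm_le_norm_of_mem (spectrum.add_mem_add_iff (s := ‖a‖).mpr h)
    rwa [Real.norm_of_nonneg (by positivity)] at this

/-- The states attaining the value `‖a‖` at all elements of norm at most `‖a‖` whose image
dominates `a`. -/
def dominatingFace (π : A →⋆ₐ[ℂ] B) (a : B) : Set (WeakDual ℝ A) :=
  {f | f ∈ factoringStates π ∧ ∀ b, ‖π b‖ ≤ ‖a‖ → a ≤ π b → f b = ‖a‖}

/-- A proper average of two numbers at most `‖a‖` equals `‖a‖` only if both do. -/
theorem isExtreme_dominatingFace (π : A →⋆ₐ[ℂ] B) (a : B) :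
    IsExtreme ℝ (factoringStates π) (dominatingFace π a) := by
  refine ⟨fun f hf => hf.1, ?_⟩
  rintro f hf g hg _ ⟨-, hh⟩ ⟨s, t, hs, ht, hst, rfl⟩
  refine ⟨hf, fun b hb hab => ?_⟩
  have h1 : s * f b + t * g b = ‖a‖ := hh b hb hab
  have h2 := (hf.2.1 b).trans hb
  have h3 := mul_le_mul_of_nonneg_left ((hg.2.1 b).trans hb) ht.le
  refine le_antisymm h2 (le_of_mul_le_mul_left ?_ hs)
  have h4 : ‖a‖ = s * ‖a‖ + t * ‖a‖ := by rw [← add_mul, hst, one_mul]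
  linarith

theorem isCompact_dominatingFace (π : A →⋆ₐ[ℂ] B) (a : B) : IsCompact (dominatingFace π a) := by
  have h : dominatingFace π a = factoringStates π ∩
      ⋂ b, ⋂ (_ : ‖π b‖ ≤ ‖a‖), ⋂ (_ : a ≤ π b), {f | f b = ‖a‖} := by
    ext f; simp [dominatingFace]
  rw [h]
  exact (isCompact_factoringStates π).inter_right (isClosed_iInter fun b => isClosed_iInter fun _ =>
    isClosed_iInter fun _ => isClosed_eq (WeakDual.eval_continuous b) continuous_const)

variable [StarOrderedRing B]

theorem nonempty_dominatingFace (π : A →⋆ₐ[ℂ] B) {a : B} (ha : IsSelfAdjoint a) (ha0 : a ≠ 0)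
    (h : ‖a‖ ∈ spectrum ℝ a) : (dominatingFace π a).Nonempty := by
  have : Nontrivial B := ⟨a, 0, ha0⟩
  have hpos : 0 < ‖a‖ := norm_pos_iff.mpr ha0
  -- The attained norm is `2‖a‖ = ‖a‖ ψ 1 + ψ a` with both terms at most `‖a‖`, so `ψ 1 = 1` and `ψ
  -- a = ‖a‖`.
  obtain ⟨ψ, hψ, hψa⟩ := exists_dual_vector'' ℝ (algebraMap ℝ B ‖a‖ + a)
  have hle (x : B) : ψ x ≤ ‖x‖ :=
    (le_abs_self _).trans ((ψ.le_of_opNorm_le hψ x).trans_eq (one_mul _))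
  rw [norm_add_norm_of_mem_spectrum h, map_add, Algebra.algebraMap_eq_smul_one, map_smul] at hψa
  have h1 := hle 1
  rw [norm_one] at h1
  have h2 := hle a
  have h3 := mul_le_mul_of_nonneg_left h1 hpos.le
  simp only [smul_eq_mul, RCLike.ofReal_real_eq_id, id] at hψa
  have hψ1 : ψ 1 = 1 := by
    refine le_antisymm h1 (le_of_mul_le_mul_left ?_ hpos)
    linarith
  have hψa' : ψ a = ‖a‖ := by rw [hψ1] at hψa; linarith
  -- Averaging over `star` supplies the required invariance without changing values at elements with
  -- self-adjoint image.
  let l : A →ₗ[ℝ] ℝ :=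
    { toFun x := 2⁻¹ * (ψ (π x) + ψ (star (π x)))
      map_add' x y := by simp only [map_add, star_add]; ring
      map_smul' c x := by
        simp only [StarAlgHom.map_real_smul, star_smul, star_trivial, map_smul, smul_eq_mul,
          RingHom.id_apply]
        ring }
  have hl (x : A) : l x = 2⁻¹ * (ψ (π x) + ψ (star (π x))) := rfl
  obtain ⟨f, hf, hfl⟩ := exists_mem_factoringStates (π := π) l (by rw [hl]; simp [hψ1]; norm_num)
    (fun x => by
      rw [hl]
      have h1 := hle (π x)
      have h2 := hle (star (π x))
      rw [norm_star] at h2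
      linarith)
    (fun x => by rw [hl, hl, map_star, star_star, add_comm])
  refine ⟨f, hf, fun b hb hab => ?_⟩
  have hbs : IsSelfAdjoint (π b) := by
    have := (sub_nonneg.mpr hab).isSelfAdjoint.add ha
    rwa [sub_add_cancel] at this
  have hfb : f b = ψ (π b) := by rw [hfl, hl, hbs.star_eq]; ring
  refine le_antisymm ((hf.2.1 b).trans hb) ?_
  have hd : 0 ≤ π b - a := sub_nonneg.mpr hab
  set d := π b - a with hd'
  have h5 : ‖algebraMap ℝ B ‖d‖ - d‖ ≤ ‖d‖ := by
    rw [CStarAlgebra.norm_le_iff_le_algebraMap _ (norm_nonneg _)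
      (sub_nonneg.mpr (IsSelfAdjoint.le_algebraMap_norm_self hd.isSelfAdjoint))]
    exact sub_le_self _ hd
  have h6 := (hle _).trans h5
  rw [map_sub, Algebra.algebraMap_eq_smul_one, map_smul, hψ1, smul_eq_mul, mul_one, hd', map_sub,
    hψa'] at h6
  rw [hfb]
  linarith

/-- If `(X, π(A))` is unperforated, then the norm of `a ∈ X` is attained at a state of `B` that
restricts to a pure state of `π(A)`. -/
theorem exists_pure_state_of_isUnperforated {X : Submodule ℂ B}
    (hX : IsUnperforated X (LinearMap.range π.toAlgHom.toLinearMap)) {a : B} (haX : a ∈ X)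
    (ha : IsSelfAdjoint a) (ha0 : a ≠ 0) (h : ‖a‖ ∈ spectrum ℝ a) :
    ∃ ψ : B →ₚ[ℂ] ℂ, ∃ f ∈ (factoringStates π).extremePoints ℝ,
      (∀ x, (ψ (π x)).re = f x) ∧ ‖a‖ ≤ (ψ a).re := by
  have : LocallyConvexSpace ℝ (WeakDual ℝ A) :=
    inferInstanceAs (LocallyConvexSpace ℝ (WeakBilin (topDualPairing ℝ A)))
  obtain ⟨f, hf⟩ := (isCompact_dominatingFace π a).extremePoints_nonempty
    (nonempty_dominatingFace π ha ha0 h)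
  have hfK : f ∈ factoringStates π := hf.1.1
  have hdom (b : A) (hb : a + star a ≤ π b + star (π b)) : ‖a‖ ≤ f b := by
    have hb2 : a ≤ π ((2⁻¹ : ℝ) • (b + star b)) := by
      have := smul_le_smul_of_nonneg_left hb (show (0 : ℝ) ≤ 2⁻¹ by norm_num)
      rw [ha.star_eq, ← two_smul ℝ a, smul_smul, inv_mul_cancel₀ two_ne_zero, one_smul] at this
      rwa [StarAlgHom.map_real_smul, map_add, map_star]
    -- Unperforation puts `π c`, of norm at most `‖a‖`, between `a` and the real part of `π b`;
    -- there the face prescribes `f c = ‖a‖`.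
    obtain ⟨_, ⟨c, rfl⟩, -, hc1, hc2, hc3⟩ := hX a haX ha _ ⟨(2⁻¹ : ℝ) • (b + star b), rfl⟩
      ((IsSelfAdjoint.smul (.all _) (IsSelfAdjoint.add_star_self b)).map π) hb2
    have h1 : f c = ‖a‖ := hf.1.2 c hc1 hc2
    have h2 := factoringStates.mono hfK (x := c) hc3
    rw [map_smul, map_add, hfK.2.2, smul_eq_mul] at h2
    linarith
  obtain ⟨ψ, hψ1, hψ2⟩ := exists_positive_extension hfK ha0 hdom
  exact ⟨ψ, f, (isExtreme_dominatingFace π a).extremePoints_subset_extremePoints hf, hψ1, hψ2⟩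

variable [PartialOrder A] [StarOrderedRing A]

theorem exists_vector_mem_factoringStates {f : A →ₚ[ℂ] ℂ} {ψ : B →ₚ[ℂ] ℂ}
    (hf : ∀ a, f a = ψ (π a)) (η : f.GNS) (hη : η ≠ 0) :
    ∃ g ∈ factoringStates π, ∀ x, ‖η‖ ^ 2 * g x = (⟪η, f.gnsStarAlgHom x η⟫_ℂ).re := by
  have hη2 : 0 < ‖η‖ ^ 2 := by positivity
  let l : A →ₗ[ℝ] ℝ :=
    { toFun x := (‖η‖ ^ 2)⁻¹ * (⟪η, f.gnsStarAlgHom x η⟫_ℂ).re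
      map_add' x y := by
        rw [map_add, add_apply, inner_add_right, Complex.add_re, mul_add]
      map_smul' c x := by
        rw [StarAlgHom.map_real_smul, smul_apply, inner_smul_right_eq_smul,
          Complex.smul_re, RingHom.id_apply, smul_eq_mul, smul_eq_mul]
        ring }
  have hl (x : A) : l x = (‖η‖ ^ 2)⁻¹ * (⟪η, f.gnsStarAlgHom x η⟫_ℂ).re := rfl
  obtain ⟨g, hg, hgl⟩ := exists_mem_factoringStates (π := π) l
    (by
      rw [hl, map_one, one_apply_eq_self, inner_self_eq_norm_sq_to_K]
      norm_cast
      exact inv_mul_cancel₀ hη2.ne')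
    (fun x => by
      rw [hl, inv_mul_le_iff₀ hη2]
      calc (⟪η, f.gnsStarAlgHom x η⟫_ℂ).re ≤ ‖η‖ * ‖f.gnsStarAlgHom x η‖ :=
            re_inner_le_norm (𝕜 := ℂ) _ _
        _ ≤ ‖η‖ * (‖π x‖ * ‖η‖) := by
            gcongr; exact PositiveLinearMap.norm_gnsStarAlgHom_le π hf x η
        _ = ‖η‖ ^ 2 * ‖π x‖ := by ring)
    (fun x => by
      rw [hl, hl, PositiveLinearMap.inner_gnsStarAlgHom_right, star_star, ← inner_conj_symm,
        Complex.conj_re])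
  refine ⟨g, hg, fun x => ?_⟩
  rw [hgl, hl, mul_inv_cancel_left₀ hη2.ne']

/-- A splitting of `f` into two vector functionals is, after normalization, a convex combination of
factoring states with weights `‖η‖²` and `‖η'‖²`, so extremality applies. -/
theorem isIrreducibleRep_of_mem_extremePoints {f : A →ₚ[ℂ] ℂ} {ψ : B →ₚ[ℂ] ℂ}
    (hf : ∀ a, f a = ψ (π a)) {f₀ : WeakDual ℝ A} (h₀ : f₀ ∈ (factoringStates π).extremePoints ℝ)
    (hre : ∀ x, (f x).re = f₀ x) : IsIrreducibleRep f.gnsStarAlgHom := by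
  have hf1 : f 1 = 1 := by
    have h1 : 0 ≤ f 1 := f.map_nonneg zero_le_one
    refine Complex.ext ?_ ?_
    · rw [hre, h₀.1.1, Complex.one_re]
    · rw [← (Complex.nonneg_iff.mp h1).2, Complex.one_im]
  refine f.isIrreducibleRep_gnsStarAlgHom hf1 fun η η' hηη' => ?_
  have hsum : ‖η‖ ^ 2 + ‖η'‖ ^ 2 = 1 := by
    have := hηη' 1
    rw [hf1, map_one, one_apply_eq_self, one_apply_eq_self,
      inner_self_eq_norm_sq_to_K, inner_self_eq_norm_sq_to_K] at this
    have h2 := congrArg Complex.re this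
    norm_cast at h2
    exact h2.symm
  -- Real parts suffice: imaginary parts are recovered by replacing `a` with `i a`.
  suffices hmain : ∀ a, (⟪η, f.gnsStarAlgHom a η⟫_ℂ).re = ‖η‖ ^ 2 * (f a).re by
    intro a
    have h1 := hmain a
    have h2 := hmain (Complex.I • a)
    simp only [map_smul, smul_apply, inner_smul_right, smul_eq_mul,
      Complex.I_mul_re, mul_neg, neg_inj] at h2
    rw [← Complex.ofReal_pow]
    refine Complex.ext ?_ ?_
    · rw [Complex.re_ofReal_mul, h1]
    · rw [Complex.im_ofReal_mul, h2]
  intro a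
  rcases eq_or_ne η 0 with rfl | hη
  · simp
  rcases eq_or_ne η' 0 with rfl | hη'
  · have := hηη' a
    rw [inner_zero_left, add_zero] at this
    rw [norm_zero, zero_pow two_ne_zero, add_zero] at hsum
    rw [hsum, one_mul, this]
  obtain ⟨g, hg, hgη⟩ := exists_vector_mem_factoringStates hf η hη
  obtain ⟨g', hg', hgη'⟩ := exists_vector_mem_factoringStates hf η' hη'
  have hgf : g = f₀ := h₀.2 hg hg' ⟨‖η‖ ^ 2, ‖η'‖ ^ 2, by positivity, by positivity, hsum, by
    refine DFunLike.ext _ _ fun x => ?_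
    change ‖η‖ ^ 2 * g x + ‖η'‖ ^ 2 * g' x = f₀ x
    rw [hgη, hgη', ← Complex.add_re, ← hηη', hre]⟩
  rw [← hgη, hgf, hre]

/-- If the GNS representation of `ψ ∘ π` has the unique extension property relative to `s`, then
a completely positive map agreeing with `π` on `s` agrees with `π` at `ψ`. -/
theorem state_apply_eq_of_unique_extension {f : A →ₚ[ℂ] ℂ} {ψ : B →ₚ[ℂ] ℂ}
    (hf : ∀ a, f a = ψ (π a)) {s : Set A}
    (hs : ∀ φ : A →CP (f.GNS →L[ℂ] f.GNS), (∀ a ∈ s, φ a = f.gnsStarAlgHom a) →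
      ∀ a, φ a = f.gnsStarAlgHom a)
    {Φ : A →CP B} (hΦ : ∀ a ∈ s, Φ a = π a) (x : A) : ψ (Φ x) = ψ (π x) := by
  set V := PositiveLinearMap.gnsMap π hf with hV
  have hVV := PositiveLinearMap.adjoint_gnsMap_comp_gnsMap π hf
  -- On `s` the compression is the GNS representation of `f`, since `V` intertwines and `V* V = 1`.
  have hφ := hs (Φ.compression ψ.gnsStarAlgHom V hVV) (fun a ha => by
    rw [CompletelyPositiveMap.compression_apply, hΦ a ha]
    ext1 y
    change ContinuousLinearMap.adjoint V (ψ.gnsStarAlgHom (π a) (V y)) = f.gnsStarAlgHom a y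
    rw [hV, ← PositiveLinearMap.gnsMap_gnsStarAlgHom, adjoint_apply_self _ hVV]) x
  have h2 := congrArg (fun T => ⟪f.gnsVector, T f.gnsVector⟫_ℂ) hφ
  simp only [CompletelyPositiveMap.compression_apply, ContinuousLinearMap.comp_apply,
    ContinuousLinearMap.adjoint_inner_right] at h2
  rwa [hV, PositiveLinearMap.gnsMap_gnsVector, PositiveLinearMap.inner_gnsVector,
    PositiveLinearMap.inner_gnsVector, hf] at h2

end ExtremeStates

theorem exists_isSelfAdjoint_apply_ne {A : Type*} [CStarAlgebra A] {V : Type*} [AddCommGroup V]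
    [Module ℂ V] {l : A →ₗ[ℂ] V} (hl : l ≠ 0) : ∃ x, IsSelfAdjoint x ∧ l x ≠ 0 := by
  by_contra! h
  refine hl (LinearMap.ext fun x => ?_)
  rw [← realPart_add_I_smul_imaginaryPart x, map_add, map_smul, h _ (realPart x).2,
    h _ (imaginaryPart x).2]
  simp

/-! ### The main theorem -/

section Main

open scoped ComplexOrder InnerProductSpace

variable {K : Type u} [NormedAddCommGroup K] [InnerProductSpace ℂ K] [CompleteSpace K]
  {S : OperatorSystem K}
  {H : Type v} [NormedAddCommGroup H] [InnerProductSpace ℂ H] [CompleteSpace H]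

/-- A completely positive map agreeing with `π` on `S` agrees with `π` on all of `C*(S)` at the
states which are pure on `π(C*(S))`. -/
theorem OperatorSystem.state_apply_eq
    (hirr : ∀ (L : Type u) [NormedAddCommGroup L] [InnerProductSpace ℂ L] [CompleteSpace L]
      (σ : S.cstar →⋆ₐ[ℂ] (L →L[ℂ] L)), IsIrreducibleRep σ → S.IsBoundaryRep σ)
    {π : S.cstar →⋆ₐ[ℂ] (H →L[ℂ] H)} {Φ : S.cstar →CP (H →L[ℂ] H)}
    (hext : ∀ a : S.cstar, (a : K →L[ℂ] K) ∈ S.carrier → Φ a = π a)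
    {ψ : (H →L[ℂ] H) →ₚ[ℂ] ℂ} {f₀ : WeakDual ℝ S.cstar}
    (h₀ : f₀ ∈ (factoringStates π).extremePoints ℝ) (hre : ∀ x, (ψ (π x)).re = f₀ x)
    (x : S.cstar) : ψ (Φ x) = ψ (π x) := by
  -- The state is pulled back to `C*(S)`, so its GNS space lies in the universe of `K`, where `hirr`
  -- applies.
  let f : S.cstar →ₚ[ℂ] ℂ := PositiveLinearMap.mk₀ (ψ.toLinearMap ∘ₗ π.toAlgHom.toLinearMap)
    fun x hx => ψ.map_nonneg (map_nonneg π hx)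
  have hf (a : S.cstar) : f a = ψ (π a) := rfl
  have hσ := (hirr _ _ (isIrreducibleRep_of_mem_extremePoints hf h₀ hre)).2
  exact state_apply_eq_of_unique_extension hf (s := {a | (a : K →L[ℂ] K) ∈ S.carrier})
    (fun φ hφ a => congrArg (· a) (hσ φ hφ)) hext x

theorem OperatorSystem.eq_of_isUnperforated
    (hirr : ∀ (L : Type u) [NormedAddCommGroup L] [InnerProductSpace ℂ L] [CompleteSpace L]
      (σ : S.cstar →⋆ₐ[ℂ] (L →L[ℂ] L)), IsIrreducibleRep σ → S.IsBoundaryRep σ)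
    {π : S.cstar →⋆ₐ[ℂ] (H →L[ℂ] H)} {Φ : S.cstar →CP (H →L[ℂ] H)}
    (hext : ∀ a : S.cstar, (a : K →L[ℂ] K) ∈ S.carrier → Φ a = π a)
    (hunp : IsUnperforated (LinearMap.range (Φ.toLinearMap - π.toAlgHom.toLinearMap))
      (LinearMap.range π.toAlgHom.toLinearMap)) (a : S.cstar) : Φ a = π a := by
  by_contra hne
  obtain ⟨x, hx, hx0⟩ := exists_isSelfAdjoint_apply_ne
    (l := Φ.toLinearMap - π.toAlgHom.toLinearMap)
    fun h => hne (sub_eq_zero.mp (congrArg (· a) h))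
  change Φ x - π x ≠ 0 at hx0
  have hsa (y : S.cstar) (hy : IsSelfAdjoint y) : IsSelfAdjoint (Φ y - π y) :=
    (hy.map Φ).sub (hy.map π)
  have : Nontrivial (H →L[ℂ] H) := ⟨_, _, hx0⟩
  obtain ⟨y, hy, hy0, hspec⟩ : ∃ y, IsSelfAdjoint y ∧ Φ y - π y ≠ 0 ∧
      ‖Φ y - π y‖ ∈ spectrum ℝ (Φ y - π y) := by
    -- Changing the sign of `x` if necessary makes the norm itself, not its negative, a spectral
    -- value.
    rcases CStarAlgebra.norm_or_neg_norm_mem_spectrum (hsa x hx) with h | h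
    · exact ⟨x, hx, hx0, h⟩
    · have hneg : Φ (-x) - π (-x) = -(Φ x - π x) := by rw [map_neg, map_neg]; abel
      refine ⟨-x, hx.neg, ?_, ?_⟩
      · rwa [hneg, neg_ne_zero]
      · rwa [hneg, norm_neg, ← spectrum.neg_eq, Set.mem_neg]
  obtain ⟨ψ, f₀, h₀, hre, hle⟩ := exists_pure_state_of_isUnperforated hunp
    ⟨y, rfl⟩ (hsa y hy) hy0 hspec
  change ‖Φ y - π y‖ ≤ (ψ (Φ y - π y)).re at hle
  rw [map_sub, OperatorSystem.state_apply_eq hirr hext h₀ hre, sub_self, Complex.zero_re] at hle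
  exact absurd hle (not_le.mpr (norm_pos_iff.mpr hy0))

end Main

theorem corollary5p3 {K : Type u} [NormedAddCommGroup K] [InnerProductSpace ℂ K] [CompleteSpace K]
    (S : OperatorSystem K) (hsep : TopologicalSpace.IsSeparable (S.carrier : Set (K →L[ℂ] K)))
    (hirr : ∀ (L : Type u) [NormedAddCommGroup L] [InnerProductSpace ℂ L] [CompleteSpace L]
      (σ : S.cstar →⋆ₐ[ℂ] (L →L[ℂ] L)), IsIrreducibleRep σ → S.IsBoundaryRep σ)
    {H : Type v} [NormedAddCommGroup H] [InnerProductSpace ℂ H] [CompleteSpace H]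
    (π : S.cstar →⋆ₐ[ℂ] (H →L[ℂ] H)) (Φ : S.cstar →CP (H →L[ℂ] H)) (hunital : Φ 1 = 1)
    (hext : ∀ a : S.cstar, (a : K →L[ℂ] K) ∈ S.carrier → Φ a = π a) :
    (IsUnperforated (LinearMap.range (Φ.toLinearMap - π.toAlgHom.toLinearMap))
        (LinearMap.range π.toAlgHom.toLinearMap) ↔ ∀ a : S.cstar, Φ a = π a) ∧
    ((∀ x ∈ LinearMap.range (Φ.toLinearMap - π.toAlgHom.toLinearMap),
        ∀ y ∈ LinearMap.range π.toAlgHom.toLinearMap, Commute x y) →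
      ∀ a : S.cstar, Φ a = π a) := by
  have main := OperatorSystem.eq_of_isUnperforated hirr hext
  refine ⟨⟨main, fun h => ?_⟩, fun h => main (isUnperforated_of_commute _ π h)⟩
  rintro _ ⟨x, rfl⟩ - b - - hab
  have hx : (Φ.toLinearMap - π.toAlgHom.toLinearMap) x = 0 := sub_eq_zero.mpr (h x)
  rw [hx] at hab ⊢
  exact ⟨0, zero_mem _, .zero _, le_rfl, le_rfl, hab⟩
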